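/- Let $d\ge 1$ and let $(\omega_n)_{n\in\mathbb Z^d}$ be independent, identically distributed real random variables on a probability space $(\Omega,\mathcal A,\mathbb P)$, with an arbitrary common distribution. On $\ell^2(\mathbb Z^d)$ let $h_\omega$ be the self-adjoint operator $$(h_\omega u)(n) = -\sum_{k\in\mathbb Z^d,\ |k|=1} u(n+k) + \omega_n u(n),\qquad D(h_\omega)=\Big\{u\in\ell^2(\mathbb Z^d):\ \sum_n|\omega_n u(n)|^2<\infty\Big\},$$ where $|k|=|k_1|+\dots+|k_d|$. Let $(e_j)_{j\in\mathbb Z^d}$ be the canonical orthonormal basis of $\ell^2(\mathbb Z^d)$, and let $I\subset\mathbb R$ be an open interval. Suppose that dynamical localization holds in $I$, i.e. there are constants $C<\infty$ and $m>0$ such that $$\mathbb E\Big(\sup_{t\in\mathbb R}\big|\langle e_j, e^{-ith_\omega}\chi_I(h_\omega)e_k\rangle\big|\Big)\le C e^{-m|j-k|}\qquad\text{for all } j,k\in\mathbb Z^d,$$ where $e^{-ith_\omega}$ and the spectral projection $\chi_I(h_\omega)$ are defined by the functional calculus for self-adjoint operators. Then, for $\mathbb P$-almost every $\omega$, $h_\omega$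 has pure point spectrum in $I$, i.e. $P_{\rm cont}(h_\omega)\,\chi_I(h_\omega)=0$, where $P_{\rm cont}(h_\omega)$ is the orthogonal projection onto the continuous spectral subspace of $h_\omega$ (the orthogonal complement of the closed span of its eigenvectors). -/

import Mathlib

open MeasureTheory ProbabilityTheory Filter Topology
open scoped ENNReal InnerProductSpace

noncomputable section

namespace Anderson

/-! ### Spectral measures and the Borel functional calculus of a self-adjoint operator -/

section SpectralMeasure

variable {H : Type*} [NormedAddCommGroup H] [InnerProductSpace ℂ H] [CompleteSpace H]

/-- A projection-valued measure on the Borel sets of `ℝ`: orthogonal projections `E B`, strongly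
countably additive, with `E ℝ = 1` and `E (A ∩ B) = E A * E B`.
Values on non-measurable sets are irrelevant. -/
structure ProjValuedMeasure (H : Type*) [NormedAddCommGroup H] [InnerProductSpace ℂ H]
    [CompleteSpace H] where
  proj : Set ℝ → (H →L[ℂ] H)
  isStarProjection : ∀ B, MeasurableSet B → IsStarProjection (proj B)
  proj_univ : proj Set.univ = 1
  proj_inter : ∀ A B, MeasurableSet A → MeasurableSet B → proj (A ∩ B) = proj A * proj B
  hasSum_iUnion : ∀ f : ℕ → Set ℝ, (∀ i, MeasurableSet (f i)) →
    Pairwise (Function.onFun Disjoint f) → ∀ ψ : H,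
      HasSum (fun i => proj (f i) ψ) (proj (⋃ i, f i) ψ)

namespace ProjValuedMeasure

variable (E : ProjValuedMeasure H)

theorem inner_proj {B : Set ℝ} (hB : MeasurableSet B) (φ ψ : H) :
    ⟪φ, E.proj B ψ⟫_ℂ = ⟪E.proj B φ, E.proj B ψ⟫_ℂ := by
  have h := E.isStarProjection B hB
  have h1 : E.proj B ψ = E.proj B (E.proj B ψ) := by
    conv_lhs => rw [← h.isIdempotentElem.eq]
    rfl
  have h2 : ContinuousLinearMap.adjoint (E.proj B) = E.proj B := h.isSelfAdjoint
  conv_lhs => rw [h1]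
  rw [← ContinuousLinearMap.adjoint_inner_left, h2]

theorem inner_proj_self {B : Set ℝ} (hB : MeasurableSet B) (ψ : H) :
    ⟪ψ, E.proj B ψ⟫_ℂ = ((‖E.proj B ψ‖ ^ 2 : ℝ) : ℂ) := by
  rw [E.inner_proj hB, inner_self_eq_norm_sq_to_K]
  norm_cast

theorem proj_empty : E.proj ∅ = 0 := by
  ext ψ
  have h := (E.hasSum_iUnion (fun _ => ∅) (fun _ => MeasurableSet.empty)
    (fun _ _ _ => by simp [Function.onFun]) ψ).summable
  simpa using (summable_const_iff _).1 h

theorem hasSum_norm_sq (f : ℕ → Set ℝ) (hf : ∀ i, MeasurableSet (f i))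
    (hd : Pairwise (Function.onFun Disjoint f)) (ψ : H) :
    HasSum (fun i => ‖E.proj (f i) ψ‖ ^ 2) (‖E.proj (⋃ i, f i) ψ‖ ^ 2) := by
  have h := (E.hasSum_iUnion f hf hd ψ).mapL (innerSL ℂ ψ)
  simp only [innerSL_apply_apply] at h
  rw [E.inner_proj_self (MeasurableSet.iUnion hf)] at h
  simp only [fun i => E.inner_proj_self (hf i) ψ] at h
  exact_mod_cast h

/-- The scalar spectral measure `B ↦ ⟨ψ, E B ψ⟩ = ‖E B ψ‖²` of a vector `ψ`. -/
def measure (ψ : H) : Measure ℝ :=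
  Measure.ofMeasurable (fun B _ => ENNReal.ofReal (‖E.proj B ψ‖ ^ 2))
    (by simp [E.proj_empty])
    (by
      intro f hf hd
      have h := E.hasSum_norm_sq f hf hd ψ
      rw [← h.tsum_eq, ENNReal.ofReal_tsum_of_nonneg (fun _ => by positivity) h.summable])

theorem measure_apply (ψ : H) {B : Set ℝ} (hB : MeasurableSet B) :
    E.measure ψ B = ENNReal.ofReal (‖E.proj B ψ‖ ^ 2) :=
  Measure.ofMeasurable_apply B hB

theorem measure_real_apply (ψ : H) {B : Set ℝ} (hB : MeasurableSet B) :
    (E.measure ψ).real B = ‖E.proj B ψ‖ ^ 2 := by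
  rw [Measure.real, E.measure_apply ψ hB, ENNReal.toReal_ofReal (by positivity)]

instance (ψ : H) : IsFiniteMeasure (E.measure ψ) :=
  ⟨by rw [E.measure_apply ψ MeasurableSet.univ]; exact ENNReal.ofReal_lt_top⟩

/-- The integral of a complex simple function against a projection-valued measure. -/
def simpleOp (s : SimpleFunc ℝ ℂ) : H →L[ℂ] H :=
  ∑ c ∈ s.range, c • E.proj (s ⁻¹' {c})

theorem simpleOp_sub (s t : SimpleFunc ℝ ℂ) :
    E.simpleOp (s - t) = E.simpleOp s - E.simpleOp t := by
  let T : Set ℝ → (ℂ →L[ℝ] (H →L[ℂ] H)) := fun B =>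
    (ContinuousLinearMap.id ℝ ℂ).smulRight (E.proj B)
  have hT : ∀ u : SimpleFunc ℝ ℂ, E.simpleOp u = SimpleFunc.setToSimpleFunc T u := fun u => rfl
  have hadd : FinMeasAdditive (0 : Measure ℝ) T := by
    intro A B hA hB _ _ hAB
    have key : E.proj (A ∪ B) = E.proj A + E.proj B := by
      ext ψ
      let f : ℕ → Set ℝ := fun n => if n = 0 then A else if n = 1 then B else ∅
      have hfm : ∀ i, MeasurableSet (f i) := by
        intro i; simp only [f]; split_ifs <;> simp [hA, hB]
      have hfd : Pairwise (Function.onFun Disjoint f) := by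
        intro i j hij
        simp only [Function.onFun, f]
        split_ifs <;> simp_all [disjoint_comm]
      have hU : (⋃ i, f i) = A ∪ B := by
        ext x
        simp only [Set.mem_iUnion, Set.mem_union, f]
        constructor
        · rintro ⟨i, hi⟩
          split_ifs at hi <;> simp_all
        · rintro (h | h)
          · exact ⟨0, by simpa using h⟩
          · exact ⟨1, by simpa using h⟩
      have h1 := E.hasSum_iUnion f hfm hfd ψ
      rw [hU] at h1
      have h2 : HasSum (fun i => E.proj (f i) ψ) (∑ i ∈ Finset.range 2, E.proj (f i) ψ) := by
        apply hasSum_sum_of_ne_finset_zero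
        intro b hb
        have h0 : b ≠ 0 ∧ b ≠ 1 := by
          simp only [Finset.mem_range, not_lt] at hb
          omega
        simp [f, h0.1, h0.2, E.proj_empty]
      rw [h1.unique h2]
      simp [Finset.sum_range_succ, f]
    ext
    simp [T, key]
  rw [hT, hT, hT]
  exact SimpleFunc.setToSimpleFunc_sub T hadd (by simp) (by simp)

theorem inner_simpleOp (s : SimpleFunc ℝ ℂ) (ψ : H) :
    ⟪ψ, E.simpleOp s ψ⟫_ℂ = ∫ x, s x ∂(E.measure ψ) := by
  rw [← SimpleFunc.integral_eq_integral s s.integrable_of_isFiniteMeasure,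
    SimpleFunc.integral_eq, simpleOp, _root_.sum_apply, inner_sum]
  refine Finset.sum_congr rfl fun c _ => ?_
  rw [_root_.smul_apply, inner_smul_right,
    E.inner_proj_self (s.measurableSet_fiber c), E.measure_real_apply ψ (s.measurableSet_fiber c),
    Complex.real_smul, mul_comm]

theorem norm_sq_simpleOp (s : SimpleFunc ℝ ℂ) (ψ : H) :
    ‖E.simpleOp s ψ‖ ^ 2 = ∫ x, ‖s x‖ ^ 2 ∂(E.measure ψ) := by
  have hint : ∫ x, ‖s x‖ ^ 2 ∂(E.measure ψ)
      = ∑ c ∈ s.range, ‖c‖ ^ 2 * ‖E.proj (s ⁻¹' {c}) ψ‖ ^ 2 := by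
    have h1 : ∀ x, ‖s x‖ ^ 2 = ((s.map fun c : ℂ => ‖c‖ ^ 2) : SimpleFunc ℝ ℝ) x := fun x => rfl
    simp_rw [h1]
    rw [← SimpleFunc.integral_eq_integral _ (SimpleFunc.integrable_of_isFiniteMeasure _),
      SimpleFunc.map_integral s _ s.integrable_of_isFiniteMeasure (by simp)]
    refine Finset.sum_congr rfl fun c _ => ?_
    rw [E.measure_real_apply ψ (s.measurableSet_fiber c), smul_eq_mul, mul_comm]
  have horth : ⟪E.simpleOp s ψ, E.simpleOp s ψ⟫_ℂ
      = ∑ c ∈ s.range, ((‖c‖ ^ 2 * ‖E.proj (s ⁻¹' {c}) ψ‖ ^ 2 : ℝ) : ℂ) := by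
    rw [simpleOp, _root_.sum_apply, sum_inner]
    refine Finset.sum_congr rfl fun c hc => ?_
    rw [inner_sum, Finset.sum_eq_single_of_mem c hc]
    · rw [_root_.smul_apply, inner_self_eq_norm_sq_to_K, norm_smul]
      push_cast
      simp [mul_pow]
    · intro b _ hbc
      have hd : (s ⁻¹' {c}) ∩ (s ⁻¹' {b}) = ∅ := by
        ext x
        simp only [Set.mem_inter_iff, Set.mem_preimage, Set.mem_singleton_iff,
          Set.mem_empty_iff_false, iff_false, not_and]
        rintro h1 h2
        exact hbc (h2.symm.trans h1)
      have h0 := E.proj_inter _ _ (s.measurableSet_fiber c) (s.measurableSet_fiber b)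
      rw [hd, E.proj_empty] at h0
      have hadj : ContinuousLinearMap.adjoint (E.proj (s ⁻¹' {c})) = E.proj (s ⁻¹' {c}) :=
        (E.isStarProjection _ (s.measurableSet_fiber c)).isSelfAdjoint
      have h2 : ⟪E.proj (s ⁻¹' {c}) ψ, E.proj (s ⁻¹' {b}) ψ⟫_ℂ = 0 := by
        rw [← hadj, ContinuousLinearMap.adjoint_inner_left]
        have : E.proj (s ⁻¹' {c}) (E.proj (s ⁻¹' {b}) ψ) = 0 := by
          change (E.proj (s ⁻¹' {c}) * E.proj (s ⁻¹' {b})) ψ = 0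
          rw [← h0]; rfl
        rw [this, inner_zero_right]
      rw [_root_.smul_apply, _root_.smul_apply, inner_smul_left,
        inner_smul_right, h2, mul_zero, mul_zero]
  rw [hint]
  rw [inner_self_eq_norm_sq_to_K] at horth
  apply Complex.ofReal_injective
  push_cast at horth ⊢
  simpa using horth

/-- For bounded Borel `f` there is a bounded operator `A` with `⟨ψ, A ψ⟩ = ∫ f d⟨ψ, E ψ⟩`. -/
theorem exists_integral {f : ℝ → ℂ} (hf : Measurable f) {C : ℝ} (hC : ∀ x, ‖f x‖ ≤ C) :
    ∃ A : H →L[ℂ] H, ∀ ψ : H, ⟪ψ, A ψ⟫_ℂ = ∫ x, f x ∂(E.measure ψ) := by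
  let s : ℕ → SimpleFunc ℝ ℂ := fun n => SimpleFunc.approxOn f hf Set.univ 0 (Set.mem_univ _) n
  have hs : ∀ x, Tendsto (fun n => s n x) atTop (𝓝 (f x)) := fun x =>
    SimpleFunc.tendsto_approxOn hf (Set.mem_univ _) (by simp)
  have hb : ∀ n x, ‖s n x‖ ≤ C + C := fun n x =>
    (SimpleFunc.norm_approxOn_zero_le hf (Set.mem_univ _) x n).trans (add_le_add (hC x) (hC x))
  have hcauchy : ∀ ψ : H, CauchySeq fun n => E.simpleOp (s n) ψ := by
    intro ψ
    have hlim : Tendsto (fun p : ℕ × ℕ => ∫ x, ‖(s p.1 - s p.2) x‖ ^ 2 ∂(E.measure ψ))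
        (atTop ×ˢ atTop) (𝓝 (∫ _, (0 : ℝ) ∂(E.measure ψ))) := by
      refine tendsto_integral_filter_of_dominated_convergence (fun _ => (C + C + (C + C)) ^ 2)
        ?_ ?_ (integrable_const _) ?_
      · exact Eventually.of_forall fun p =>
          ((s p.1 - s p.2).measurable.norm.pow_const 2).aestronglyMeasurable
      · refine Eventually.of_forall fun p => Eventually.of_forall fun x => ?_
        rw [Real.norm_of_nonneg (by positivity)]
        gcongr
        exact (norm_sub_le _ _).trans (add_le_add (hb _ _) (hb _ _))
      · refine Eventually.of_forall fun x => ?_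
        have h1 : Tendsto (fun p : ℕ × ℕ => s p.1 x - s p.2 x) (atTop ×ˢ atTop) (𝓝 (f x - f x)) :=
          ((hs x).comp tendsto_fst).sub ((hs x).comp tendsto_snd)
        simpa using (h1.norm.pow 2)
    rw [integral_zero] at hlim
    rw [cauchySeq_iff_tendsto, uniformity_eq_comap_nhds_zero, tendsto_comap_iff,
      ← prod_atTop_atTop_eq]
    rw [tendsto_zero_iff_norm_tendsto_zero]
    have h2 := hlim.sqrt
    rw [Real.sqrt_zero] at h2
    refine h2.congr fun p => ?_
    rw [← E.norm_sq_simpleOp, Real.sqrt_sq (norm_nonneg _), E.simpleOp_sub]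
    simp [Prod.map, norm_sub_rev]
  choose A hA using fun ψ => cauchySeq_tendsto_of_complete (hcauchy ψ)
  refine ⟨continuousLinearMapOfTendsto (fun n => E.simpleOp (s n)) (f := A) (tendsto_pi_nhds.2 hA),
    fun ψ => ?_⟩
  have h1 : Tendsto (fun n => ⟪ψ, E.simpleOp (s n) ψ⟫_ℂ) atTop (𝓝 ⟪ψ, A ψ⟫_ℂ) :=
    tendsto_const_nhds.inner (hA ψ)
  have h2 : Tendsto (fun n => ∫ x, s n x ∂(E.measure ψ)) atTop
      (𝓝 (∫ x, f x ∂(E.measure ψ))) :=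
    tendsto_integral_of_dominated_convergence (fun _ => C + C)
      (fun n => (s n).measurable.aestronglyMeasurable) (integrable_const _)
      (fun n => Eventually.of_forall fun x => hb n x) (Eventually.of_forall fun x => hs x)
  simp only [E.inner_simpleOp] at h1
  exact tendsto_nhds_unique h1 h2

open Classical in
/-- The operator `∫ f dE` for a bounded Borel function `f`: the unique bounded operator `A` with
`⟨ψ, A ψ⟩ = ∫ f d⟨ψ, E ψ⟩` for all `ψ`. -/
def integral (f : ℝ → ℂ) : H →L[ℂ] H :=
  if h : ∃ A : H →L[ℂ] H, ∀ ψ : H, ⟪ψ, A ψ⟫_ℂ = ∫ x, f x ∂(E.measure ψ) then h.choose else 0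

theorem inner_integral {f : ℝ → ℂ} (hf : Measurable f) {C : ℝ} (hC : ∀ x, ‖f x‖ ≤ C) (ψ : H) :
    ⟪ψ, E.integral f ψ⟫_ℂ = ∫ x, f x ∂(E.measure ψ) := by
  have h := E.exists_integral hf hC
  rw [integral, dif_pos h]
  exact h.choose_spec ψ

end ProjValuedMeasure

/-- `E` is the spectral measure of the (possibly unbounded) operator `T`, i.e. `T = ∫ x dE(x)`:
the domain of `T` is `{ψ | ∫ x² d⟨ψ, E ψ⟩ < ∞}`, and `⟨ψ, T ψ⟩ = ∫ x d⟨ψ, E ψ⟩` on it. By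
polarization the quadratic form determines `T`. By the spectral theorem, each self-adjoint `T`
has exactly one such `E`. -/
structure IsSpectralMeasure (E : ProjValuedMeasure H) (T : H →ₗ.[ℂ] H) : Prop where
  mem_domain_iff : ∀ ψ : H, ψ ∈ T.domain ↔ Integrable (fun x : ℝ => x ^ 2) (E.measure ψ)
  inner_apply : ∀ ψ : T.domain, ⟪(ψ : H), T ψ⟫_ℂ = ((∫ x, x ∂(E.measure (ψ : H)) : ℝ) : ℂ)

open Classical in
/-- The Borel functional calculus: `f(T) = ∫ f dE` for bounded Borel `f` and self-adjoint `T`,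
where `E` is the spectral measure of `T`. (Junk value `0` if `T` has no spectral measure, which
never happens for a self-adjoint `T`.) -/
def borelCalc (T : H →ₗ.[ℂ] H) (f : ℝ → ℂ) : H →L[ℂ] H :=
  if h : ∃ E : ProjValuedMeasure H, IsSpectralMeasure E T then h.choose.integral f else 0

/-- The spectral projection `χ_B(T)`. -/
def spectralProj (T : H →ₗ.[ℂ] H) (B : Set ℝ) : H →L[ℂ] H :=
  borelCalc T (B.indicator fun _ => 1)

/-- The unitary group `e^{-itT}`. -/
def evolution (T : H →ₗ.[ℂ] H) (t : ℝ) : H →L[ℂ] H :=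
  borelCalc T fun x => Complex.exp (-Complex.I * t * x)

/-- The pure point subspace: the closed linear span of all eigenvectors of `T`. -/
def pointSubspace (T : H →ₗ.[ℂ] H) : Submodule ℂ H :=
  (Submodule.span ℂ {ψ : H | ∃ (h : ψ ∈ T.domain) (E : ℂ), T ⟨ψ, h⟩ = E • ψ}).topologicalClosure

/-- `P_cont(T)`: the orthogonal projection onto the continuous spectral subspace of `T`, the
orthogonal complement of the pure point subspace. -/
def contProj (T : H →ₗ.[ℂ] H) : H →L[ℂ] H :=
  (pointSubspace T)ᗮ.starProjection

/-- `T` has pure point spectrum in `I`, i.e. no continuous spectrum there: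
`P_cont(T) χ_I(T) = 0`. -/
def HasPurePointSpectrumIn (T : H →ₗ.[ℂ] H) (I : Set ℝ) : Prop :=
  contProj T ∘L spectralProj T I = 0

end SpectralMeasure

/-! ### The Anderson model on `ℤ^d` -/

/-- The lattice `ℤ^d`. -/
abbrev Lattice (d : ℕ) : Type := Fin d → ℤ

/-- The graph distance to the origin, `|k| = |k_1| + … + |k_d|`. -/
def graphNorm {d : ℕ} (k : Lattice d) : ℤ := ∑ i, |k i|

/-- The finite set of all `k ∈ ℤ^d` with `|k| = 1`; see `mem_unitVectors`. -/
def unitVectors (d : ℕ) : Finset (Lattice d) :=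
  (Fintype.piFinset fun _ => Finset.Icc (-1 : ℤ) 1).filter fun k => graphNorm k = 1

theorem mem_unitVectors {d : ℕ} (k : Lattice d) : k ∈ unitVectors d ↔ graphNorm k = 1 := by
  simp only [unitVectors, Finset.mem_filter, Fintype.mem_piFinset, Finset.mem_Icc,
    and_iff_right_iff_imp]
  intro h i
  have h1 : |k i| ≤ graphNorm k :=
    Finset.single_le_sum (f := fun i => |k i|) (fun _ _ => abs_nonneg _) (Finset.mem_univ i)
  rw [h] at h1
  exact abs_le.1 h1

/-- The Hilbert space `ℓ²(ℤ^d)`. -/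
abbrev L2 (d : ℕ) : Type := lp (fun _ : Lattice d => ℂ) 2

/-- The canonical basis vector `e_j`. -/
def basisVec {d : ℕ} (j : Lattice d) : L2 d := lp.single 2 j 1

/-- `(h_0 u)(n) = -∑_{|k| = 1} u(n + k)`. -/
def laplacian {d : ℕ} (u : Lattice d → ℂ) (n : Lattice d) : ℂ :=
  -∑ k ∈ unitVectors d, u (n + k)

theorem memℓp_laplacian {d : ℕ} {u : Lattice d → ℂ} (hu : Memℓp u 2) :
    Memℓp (laplacian u) 2 := by
  have hshift : ∀ k : Lattice d, Memℓp (fun n => u (n + k)) 2 := by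
    intro k
    rw [memℓp_gen_iff (by norm_num)] at hu ⊢
    exact hu.comp_injective (add_left_injective k)
  have h := (Memℓp.finsetSum (unitVectors d) (fun k _ => hshift k)).neg
  convert h using 1
  ext n
  simp [laplacian]

/-- The operator `h = h_0 + V` on `ℓ²(ℤ^d)` for the potential `v : ℤ^d → ℝ`, with the domain
`{u ∈ ℓ² | ∑ |v_n u(n)|² < ∞}` of the maximal multiplication operator. -/
def hamiltonian {d : ℕ} (v : Lattice d → ℝ) : L2 d →ₗ.[ℂ] L2 d where
  domain :=
    { carrier := {u | Memℓp (fun n => (v n : ℂ) * u n) 2}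
      zero_mem' := by
        simpa using! (zero_memℓp : Memℓp (0 : Lattice d → ℂ) 2)
      add_mem' := by
        intro a b ha hb
        have h := Memℓp.add ha hb
        have e : (fun n => (v n : ℂ) * (a + b : L2 d) n)
            = (fun n => (v n : ℂ) * a n) + fun n => (v n : ℂ) * b n := by
          ext n
          simp [mul_add]
        exact (show Memℓp (fun n => (v n : ℂ) * (a + b : L2 d) n) 2 from e ▸ h)
      smul_mem' := by
        intro c a ha
        have h := Memℓp.const_smul ha c
        have e : (fun n => (v n : ℂ) * (c • a : L2 d) n) = c • fun n => (v n : ℂ) * a n := by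
          ext n
          simp [mul_left_comm]
        exact (show Memℓp (fun n => (v n : ℂ) * (c • a : L2 d) n) 2 from e ▸ h) }
  toFun :=
    { toFun := fun u => ⟨fun n => laplacian (u : L2 d) n + (v n : ℂ) * (u : L2 d) n,
        (memℓp_laplacian (lp.memℓp (u : L2 d))).add u.2⟩
      map_add' := by
        intro a b
        ext n
        rw [lp.coeFn_add, Pi.add_apply]
        simp [laplacian, Finset.sum_add_distrib, mul_add]
        ring
      map_smul' := by
        intro c a
        ext n
        simp [laplacian, Finset.mul_sum, mul_add, mul_left_comm] }

/-- The coordinates `V n` are independent random variables with common distribution `μ`. -/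
structure IsIIDPotential {Ω : Type*} [MeasurableSpace Ω] {d : ℕ} (P : Measure Ω)
    (μ : Measure ℝ) (V : Lattice d → Ω → ℝ) : Prop where
  measurable : ∀ n, Measurable (V n)
  map_eq : ∀ n, P.map (V n) = μ
  indep : iIndepFun V P

/-- Dynamical localization of `h_ω = h_0 + V_ω` in `I`: for some `C < ∞` and `m > 0`,
`𝔼 (sup_t |⟨e_j, e^{-it h_ω} χ_I(h_ω) e_k⟩|) ≤ C e^{-m |j - k|}` for all `j, k`. The expectation
is that of an integrable random variable (the supremum is always at most `1`). -/
def DynamicallyLocalized {Ω : Type*} [MeasurableSpace Ω] {d : ℕ} (P : Measure Ω)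
    (V : Lattice d → Ω → ℝ) (I : Set ℝ) : Prop :=
  ∃ C m : ℝ, 0 < m ∧ ∀ j k : Lattice d,
    let X : Ω → ℝ := fun ω => ⨆ t : ℝ,
      ‖⟪basisVec j, evolution (hamiltonian fun n => V n ω) t
        (spectralProj (hamiltonian fun n => V n ω) I (basisVec k))⟫_ℂ‖
    Integrable X P ∧ ∫ ω, X ω ∂P ≤ C * Real.exp (-m * graphNorm (j - k))

end Anderson

end

noncomputable section

namespace Anderson

/-! Summing the localization bound over `j` shows that almost surely, for every `k`, the vector `ψ =
χ_I(h) e_k` satisfies `|⟨e_j, e^{-ith} ψ⟩| ≤ a_j` for all `t`, with `a` summable: the orbit of `ψ`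
stays concentrated on a fixed finite region up to small error. A vector `χ` whose spectral measure
has no atoms does the opposite. By Wiener's lemma `⟨e_j, e^{-inh} χ⟩` tends to zero in mean over `n
< N`, for each `j`.

The two behaviours force orthogonality. Since `e^{-ith}` is an isometry, Parseval gives `|⟨χ, ψ⟩| ≤
∑_j a_j |⟨e_j, e^{-ith} χ⟩|` for every `t`. The left side does not depend on `t`; averaged over
integer times, the right side tends to zero by dominated convergence
(`mem_orthogonal_atomlessSubspace`).

It remains to compare atoms with eigenvectors. Each `E {x} χ` is an eigenvector
(`apply_proj_singleton`), so a vector orthogonal to all eigenvectors has no atoms. Hence `P_cont`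
kills `ψ`, and the `e_k` span a dense subspace. -/

/-! ### Wiener's lemma for discrete time averages -/

/-- The Cesàro means of the powers of a complex number `q ≠ 1` of modulus one tend to zero. -/
theorem tendsto_cesaro_pow_zero {q : ℂ} (hq : ‖q‖ = 1) (hq1 : q ≠ 1) :
    Tendsto (fun N : ℕ => (N : ℂ)⁻¹ * ∑ n ∈ Finset.range N, q ^ n) atTop (𝓝 0) := by
  have h0 : Tendsto (fun N : ℕ => (N : ℝ)⁻¹ * (2 / ‖q - 1‖)) atTop (𝓝 0) := by
    simpa using (tendsto_inv_atTop_nhds_zero_nat (𝕜 := ℝ)).mul_const (2 / ‖q - 1‖)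
  refine squeeze_zero_norm (fun N => ?_) h0
  rw [geom_sum_eq hq1, norm_mul, norm_inv, norm_div, Complex.norm_natCast]
  gcongr
  calc ‖q ^ N - 1‖ ≤ ‖q ^ N‖ + ‖(1 : ℂ)‖ := norm_sub_le _ _
    _ = 2 := by rw [norm_pow, hq]; norm_num

theorem norm_exp_neg_I_mul (t x : ℝ) : ‖Complex.exp (-Complex.I * t * x)‖ = 1 := by
  rw [show -Complex.I * (t : ℂ) * x = ((-(t * x) : ℝ) : ℂ) * Complex.I by push_cast; ring]
  exact Complex.norm_exp_ofReal_mul_I _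

/-- For a finite measure without atoms, almost no difference `x - y` lies in `2πℤ`. -/
theorem ae_exp_neg_I_mul_sub_ne_one (μ : Measure ℝ) [IsFiniteMeasure μ] [NullSingletonClass μ] :
    ∀ᵐ p : ℝ × ℝ ∂(μ.prod μ), Complex.exp (-Complex.I * (p.1 - p.2 : ℝ)) ≠ 1 := by
  have hm : MeasurableSet {p : ℝ × ℝ | Complex.exp (-Complex.I * (p.1 - p.2 : ℝ)) = 1} := by
    refine measurableSet_eq_fun ?_ measurable_const
    fun_prop
  have h : (μ.prod μ) {p : ℝ × ℝ | Complex.exp (-Complex.I * (p.1 - p.2 : ℝ)) = 1} = 0 := by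
    rw [Measure.measure_prod_null hm]
    refine Eventually.of_forall fun x => ?_
    -- By Fubini it suffices to treat one `x` at a time: the bad `y` lie in `x + 2πℤ`, which is
    -- countable and so null for a measure without atoms. This is why integer times are enough.
    refine Set.Countable.measure_zero (Set.Countable.mono ?_
      (Set.countable_range fun k : ℤ => x + k * (2 * Real.pi))) μ
    intro y hy
    obtain ⟨k, hk⟩ := Complex.exp_eq_one_iff.1 hy
    refine ⟨k, ?_⟩
    have h2 : (((x + k * (2 * Real.pi) : ℝ) : ℂ)) * Complex.I = (y : ℂ) * Complex.I := by
      push_cast at hk ⊢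
      linear_combination -hk
    exact Complex.ofReal_injective (mul_right_cancel₀ Complex.I_ne_zero h2)
  rw [ae_iff]
  simpa using h

/-- **Wiener's lemma**: the Fourier coefficients of a finite measure without atoms tend to zero in
quadratic mean. -/
theorem tendsto_cesaro_norm_sq_fourier (μ : Measure ℝ) [IsFiniteMeasure μ] [NullSingletonClass μ] :
    Tendsto (fun N : ℕ => (N : ℝ)⁻¹ * ∑ n ∈ Finset.range N,
      ‖∫ x, Complex.exp (-Complex.I * (n : ℝ) * x) ∂μ‖ ^ 2) atTop (𝓝 0) := by
  have hprod : ∀ n : ℕ, ((‖∫ x, Complex.exp (-Complex.I * (n : ℝ) * x) ∂μ‖ ^ 2 : ℝ) : ℂ)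
      = ∫ p : ℝ × ℝ, Complex.exp (-Complex.I * (p.1 - p.2 : ℝ)) ^ n ∂(μ.prod μ) := by
    intro n
    -- The squared modulus is the coefficient times its conjugate, a double integral of the `n`-th
    -- power of `q = e^{-i(x-y)}`. The time average thus becomes a Cesàro mean of powers under the
    -- integral.
    have h1 := Complex.mul_conj' (∫ x, Complex.exp (-Complex.I * (n : ℝ) * x) ∂μ)
    rw [← integral_conj, ← integral_prod_mul] at h1
    push_cast at h1 ⊢
    rw [← h1]
    refine integral_congr_ae (Eventually.of_forall fun p => ?_)
    simp only [← Complex.exp_conj, ← Complex.exp_add, ← Complex.exp_nat_mul, map_mul, map_neg,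
      Complex.conj_I, Complex.conj_ofReal, map_natCast]
    congr 1
    ring
  have hnorm : ∀ p : ℝ × ℝ, ‖Complex.exp (-Complex.I * (p.1 - p.2 : ℝ))‖ = 1 := by
    intro p
    simpa using norm_exp_neg_I_mul 1 (p.1 - p.2)
  have hmeas : Measurable fun p : ℝ × ℝ => Complex.exp (-Complex.I * (p.1 - p.2 : ℝ)) := by
    fun_prop
  have hint : ∀ n : ℕ, Integrable
      (fun p : ℝ × ℝ => Complex.exp (-Complex.I * (p.1 - p.2 : ℝ)) ^ n) (μ.prod μ) := fun n =>
    Integrable.of_bound (hmeas.pow_const n).aestronglyMeasurable 1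
      (Eventually.of_forall fun p => by rw [norm_pow, hnorm, one_pow])
  have hlim : Tendsto (fun N : ℕ => ∫ p : ℝ × ℝ, (N : ℂ)⁻¹ * ∑ n ∈ Finset.range N,
      Complex.exp (-Complex.I * (p.1 - p.2 : ℝ)) ^ n ∂(μ.prod μ)) atTop
      (𝓝 (∫ _, (0 : ℂ) ∂(μ.prod μ))) := by
    refine tendsto_integral_of_dominated_convergence (fun _ => 1)
      (fun N => (Measurable.const_mul (Finset.measurable_fun_sum _
        fun n _ => hmeas.pow_const n) _).aestronglyMeasurable) (integrable_const _)
      (fun N => Eventually.of_forall fun p => ?_) ?_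
    · rw [norm_mul, norm_inv, Complex.norm_natCast]
      have h1 : ‖∑ n ∈ Finset.range N, Complex.exp (-Complex.I * (p.1 - p.2 : ℝ)) ^ n‖ ≤ N := by
        refine (norm_sum_le _ _).trans ?_
        simp only [norm_pow, hnorm, one_pow, Finset.sum_const, Finset.card_range, nsmul_eq_mul,
        mul_one, le_refl]
      calc (N : ℝ)⁻¹ * _ ≤ (N : ℝ)⁻¹ * N := by gcongr
        _ ≤ 1 := inv_mul_le_one
    · filter_upwards [ae_exp_neg_I_mul_sub_ne_one μ] with p hp
      exact tendsto_cesaro_pow_zero (hnorm p) hp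
  rw [integral_zero] at hlim
  have h2 := hlim.norm
  rw [norm_zero] at h2
  refine h2.congr fun N => ?_
  rw [integral_const_mul, integral_finsetSum _ fun n _ => hint n]
  simp_rw [← hprod]
  rw [← Complex.ofReal_sum, norm_mul, norm_inv, Complex.norm_natCast, Complex.norm_real,
    Real.norm_of_nonneg (by positivity)]

/-- Cesàro convergence of squares to zero implies that of the values. -/
theorem tendsto_cesaro_of_sq {a : ℕ → ℝ} (ha : ∀ n, 0 ≤ a n)
    (h : Tendsto (fun N : ℕ => (N : ℝ)⁻¹ * ∑ n ∈ Finset.range N, a n ^ 2) atTop (𝓝 0)) :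
    Tendsto (fun N : ℕ => (N : ℝ)⁻¹ * ∑ n ∈ Finset.range N, a n) atTop (𝓝 0) := by
  have h2 := h.sqrt
  rw [Real.sqrt_zero] at h2
  refine squeeze_zero (fun N => ?_) (fun N => ?_) h2
  · exact mul_nonneg (by positivity) (Finset.sum_nonneg fun n _ => ha n)
  · refine Real.le_sqrt_of_sq_le ?_
    rcases Nat.eq_zero_or_pos N with rfl | hN
    · simp
    have hN' : (0 : ℝ) < N := by exact_mod_cast hN
    have h3 := sq_sum_le_card_mul_sum_sq (s := Finset.range N) (f := a)
    rw [Finset.card_range] at h3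
    calc ((N : ℝ)⁻¹ * ∑ n ∈ Finset.range N, a n) ^ 2
        = (N : ℝ)⁻¹ ^ 2 * (∑ n ∈ Finset.range N, a n) ^ 2 := by ring
      _ ≤ (N : ℝ)⁻¹ ^ 2 * (N * ∑ n ∈ Finset.range N, a n ^ 2) := by gcongr
      _ = (N : ℝ)⁻¹ * ∑ n ∈ Finset.range N, a n ^ 2 := by field_simp

/-! ### More on the functional calculus of a projection-valued measure -/

/-- A bounded operator on a complex Hilbert space is determined by its quadratic form. -/
theorem eq_of_forall_inner_self {H : Type*} [NormedAddCommGroup H] [InnerProductSpace ℂ H]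
    {A B : H →L[ℂ] H} (h : ∀ ψ : H, ⟪ψ, A ψ⟫_ℂ = ⟪ψ, B ψ⟫_ℂ) : A = B := by
  have h1 : (A : H →ₗ[ℂ] H) = B := (ext_inner_map _ _).1 fun ψ => by
    change ⟪A ψ, ψ⟫_ℂ = ⟪B ψ, ψ⟫_ℂ
    rw [← inner_conj_symm, h, inner_conj_symm]
  exact ContinuousLinearMap.coe_injective h1

section Spectral

variable {H : Type*} [NormedAddCommGroup H] [InnerProductSpace ℂ H] [CompleteSpace H]

namespace ProjValuedMeasure

variable (E : ProjValuedMeasure H)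

theorem proj_proj_apply {A B : Set ℝ} (hA : MeasurableSet A) (hB : MeasurableSet B) (ψ : H) :
    E.proj A (E.proj B ψ) = E.proj (A ∩ B) ψ := by
  rw [E.proj_inter A B hA hB]
  rfl

theorem inner_proj_left {B : Set ℝ} (hB : MeasurableSet B) (φ ψ : H) :
    ⟪E.proj B φ, ψ⟫_ℂ = ⟪φ, E.proj B ψ⟫_ℂ := by
  have hadj : ContinuousLinearMap.adjoint (E.proj B) = E.proj B :=
    (E.isStarProjection B hB).isSelfAdjoint
  rw [← ContinuousLinearMap.adjoint_inner_right, hadj]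

/-- `∫ f dE` is a strong limit of integrals of simple functions converging boundedly to `f`. -/
theorem exists_tendsto_simpleOp {f : ℝ → ℂ} (hf : Measurable f) {C : ℝ} (hC : ∀ x, ‖f x‖ ≤ C) :
    ∃ s : ℕ → SimpleFunc ℝ ℂ, (∀ n x, ‖s n x‖ ≤ C + C) ∧
      (∀ x, Tendsto (fun n => s n x) atTop (𝓝 (f x))) ∧
      ∀ ψ : H, Tendsto (fun n => E.simpleOp (s n) ψ) atTop (𝓝 (E.integral f ψ)) := by
  let s : ℕ → SimpleFunc ℝ ℂ := fun n => SimpleFunc.approxOn f hf Set.univ 0 (Set.mem_univ _) n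
  have hs : ∀ x, Tendsto (fun n => s n x) atTop (𝓝 (f x)) := fun x =>
    SimpleFunc.tendsto_approxOn hf (Set.mem_univ _) (by simp)
  have hb : ∀ n x, ‖s n x‖ ≤ C + C := fun n x =>
    (SimpleFunc.norm_approxOn_zero_le hf (Set.mem_univ _) x n).trans (add_le_add (hC x) (hC x))
  have hcauchy : ∀ ψ : H, CauchySeq fun n => E.simpleOp (s n) ψ := by
    intro ψ
    have hlim : Tendsto (fun p : ℕ × ℕ => ∫ x, ‖(s p.1 - s p.2) x‖ ^ 2 ∂(E.measure ψ))
        (atTop ×ˢ atTop) (𝓝 (∫ _, (0 : ℝ) ∂(E.measure ψ))) := by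
      refine tendsto_integral_filter_of_dominated_convergence (fun _ => (C + C + (C + C)) ^ 2)
        ?_ ?_ (integrable_const _) ?_
      · exact Eventually.of_forall fun p =>
          ((s p.1 - s p.2).measurable.norm.pow_const 2).aestronglyMeasurable
      · refine Eventually.of_forall fun p => Eventually.of_forall fun x => ?_
        rw [Real.norm_of_nonneg (by positivity)]
        gcongr
        exact (norm_sub_le _ _).trans (add_le_add (hb _ _) (hb _ _))
      · refine Eventually.of_forall fun x => ?_
        have h1 : Tendsto (fun p : ℕ × ℕ => s p.1 x - s p.2 x) (atTop ×ˢ atTop) (𝓝 (f x - f x)) :=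
          ((hs x).comp tendsto_fst).sub ((hs x).comp tendsto_snd)
        simpa using (h1.norm.pow 2)
    rw [integral_zero] at hlim
    rw [cauchySeq_iff_tendsto, uniformity_eq_comap_nhds_zero, tendsto_comap_iff,
      ← prod_atTop_atTop_eq, tendsto_zero_iff_norm_tendsto_zero]
    have h2 := hlim.sqrt
    rw [Real.sqrt_zero] at h2
    refine h2.congr fun p => ?_
    rw [← E.norm_sq_simpleOp, Real.sqrt_sq (norm_nonneg _), E.simpleOp_sub]
    simp [Prod.map, norm_sub_rev]
  choose A hA using fun ψ => cauchySeq_tendsto_of_complete (hcauchy ψ)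
  let A' : H →L[ℂ] H :=
    continuousLinearMapOfTendsto (fun n => E.simpleOp (s n)) (f := A) (tendsto_pi_nhds.2 hA)
  -- `E.integral f` is only a chosen operator with the right quadratic form, and that form
  -- determines it; so it is the strong limit just built.
  have hAA' : A' = E.integral f := by
    refine eq_of_forall_inner_self fun ψ => ?_
    rw [E.inner_integral hf hC]
    have h1 : Tendsto (fun n => ⟪ψ, E.simpleOp (s n) ψ⟫_ℂ) atTop (𝓝 ⟪ψ, A' ψ⟫_ℂ) :=
      tendsto_const_nhds.inner (hA ψ)
    have h2 : Tendsto (fun n => ∫ x, s n x ∂(E.measure ψ)) atTop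
        (𝓝 (∫ x, f x ∂(E.measure ψ))) :=
      tendsto_integral_of_dominated_convergence (fun _ => C + C)
        (fun n => (s n).measurable.aestronglyMeasurable) (integrable_const _)
        (fun n => Eventually.of_forall fun x => hb n x) (Eventually.of_forall fun x => hs x)
    simp only [E.inner_simpleOp] at h1
    exact tendsto_nhds_unique h1 h2
  refine ⟨s, hb, hs, fun ψ => ?_⟩
  rw [← hAA']
  exact hA ψ

/-- The isometry for simple functions survives the strong limit. With polarization it gives
unitarity of `e^{-ith}` in the form needed, without proving that the calculus is multiplicative. -/
theorem norm_sq_integral {f : ℝ → ℂ} (hf : Measurable f) {C : ℝ} (hC : ∀ x, ‖f x‖ ≤ C) (ψ : H) :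
    ‖E.integral f ψ‖ ^ 2 = ∫ x, ‖f x‖ ^ 2 ∂(E.measure ψ) := by
  obtain ⟨s, hb, hs, hlim⟩ := E.exists_tendsto_simpleOp hf hC
  have h1 := (hlim ψ).norm.pow 2
  simp only [E.norm_sq_simpleOp] at h1
  refine tendsto_nhds_unique h1 ?_
  refine tendsto_integral_of_dominated_convergence (fun _ => (C + C) ^ 2)
    (fun n => ((s n).measurable.norm.pow_const 2).aestronglyMeasurable) (integrable_const _)
    (fun n => Eventually.of_forall fun x => ?_)
    (Eventually.of_forall fun x => (hs x).norm.pow 2)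
  rw [Real.norm_of_nonneg (by positivity)]
  gcongr
  exact hb n x

theorem integral_indicator_one {B : Set ℝ} (hB : MeasurableSet B) :
    E.integral (B.indicator fun _ => 1) = E.proj B := by
  refine eq_of_forall_inner_self fun ψ => ?_
  rw [E.inner_integral (C := 1) (measurable_const.indicator hB), E.inner_proj_self hB,
    integral_indicator_const _ hB, E.measure_real_apply ψ hB]
  · simp
  · intro x
    by_cases hx : x ∈ B <;> simp [hx]

theorem norm_integral_of_norm_eq_one {f : ℝ → ℂ} (hf : Measurable f) (h1 : ∀ x, ‖f x‖ = 1)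
    (ψ : H) : ‖E.integral f ψ‖ = ‖ψ‖ := by
  have h := E.norm_sq_integral hf (fun x => (h1 x).le) ψ
  simp only [h1, one_pow, integral_const, smul_eq_mul, mul_one,
    E.measure_real_apply ψ MeasurableSet.univ, E.proj_univ, one_apply_eq_self] at h
  exact (sq_eq_sq₀ (norm_nonneg _) (norm_nonneg _)).1 h

/-- A function of `E` with values of modulus one is an isometry. -/
theorem inner_integral_integral {f : ℝ → ℂ} (hf : Measurable f) (h1 : ∀ x, ‖f x‖ = 1)
    (φ ψ : H) : ⟪E.integral f φ, E.integral f ψ⟫_ℂ = ⟪φ, ψ⟫_ℂ :=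
  LinearIsometry.inner_map_map
    (⟨(E.integral f : H →ₗ[ℂ] H), E.norm_integral_of_norm_eq_one hf h1⟩ : H →ₗᵢ[ℂ] H) φ ψ

/-- Kernels of spectral projections are invariant under the functional calculus. -/
theorem proj_integral_eq_zero {f : ℝ → ℂ} (hf : Measurable f) {C : ℝ} (hC : ∀ x, ‖f x‖ ≤ C)
    {B : Set ℝ} (hB : MeasurableSet B) {ψ : H} (hψ : E.proj B ψ = 0) :
    E.proj B (E.integral f ψ) = 0 := by
  obtain ⟨s, -, -, hlim⟩ := E.exists_tendsto_simpleOp hf hC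
  have h0 : ∀ n, E.proj B (E.simpleOp (s n) ψ) = 0 := by
    intro n
    rw [simpleOp, _root_.sum_apply, map_sum]
    refine Finset.sum_eq_zero fun c _ => ?_
    rw [_root_.smul_apply, map_smul, E.proj_proj_apply hB ((s n).measurableSet_fiber c),
      Set.inter_comm, ← E.proj_proj_apply ((s n).measurableSet_fiber c) hB, hψ, map_zero,
      smul_zero]
  have h1 := ((E.proj B).continuous.tendsto _).comp (hlim ψ)
  refine tendsto_nhds_unique h1 ?_
  simp only [Function.comp_def, h0]
  exact tendsto_const_nhds

/-! ### The subspace of vectors without atoms -/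

/-- The vectors whose spectral measure has no atoms. -/
def atomlessSubspace : Submodule ℂ H := ⨅ x : ℝ, LinearMap.ker (E.proj {x} : H →ₗ[ℂ] H)

theorem mem_atomlessSubspace {ψ : H} : ψ ∈ E.atomlessSubspace ↔ ∀ x : ℝ, E.proj {x} ψ = 0 := by
  simp [atomlessSubspace]

theorem isClosed_atomlessSubspace : IsClosed (E.atomlessSubspace : Set H) := by
  have h : (E.atomlessSubspace : Set H) = ⋂ x : ℝ, {ψ | E.proj {x} ψ = 0} := by
    ext ψ
    simp [mem_atomlessSubspace]
  rw [h]
  exact isClosed_iInter fun x => isClosed_eq (E.proj {x}).continuous continuous_const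

theorem nullSingletonClass_measure {ψ : H} (hψ : ψ ∈ E.atomlessSubspace) :
    NullSingletonClass (E.measure ψ) :=
  ⟨fun x => by
    rw [E.measure_apply ψ (measurableSet_singleton x), E.mem_atomlessSubspace.1 hψ x]
    simp⟩

/-- The unitary `∫ e^{-itx} dE(x)`. -/
def unitaryAt (t : ℝ) : H →L[ℂ] H := E.integral fun x => Complex.exp (-Complex.I * t * x)

theorem measurable_exp_neg_I_mul (t : ℝ) :
    Measurable fun x : ℝ => Complex.exp (-Complex.I * t * x) := by
  fun_prop

theorem inner_unitaryAt_unitaryAt (t : ℝ) (φ ψ : H) :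
    ⟪E.unitaryAt t φ, E.unitaryAt t ψ⟫_ℂ = ⟪φ, ψ⟫_ℂ :=
  E.inner_integral_integral (measurable_exp_neg_I_mul t) (norm_exp_neg_I_mul t) φ ψ

theorem norm_unitaryAt (t : ℝ) (ψ : H) : ‖E.unitaryAt t ψ‖ = ‖ψ‖ :=
  E.norm_integral_of_norm_eq_one (measurable_exp_neg_I_mul t) (norm_exp_neg_I_mul t) ψ

/-- Invariance allows the test vector in `tendsto_cesaro_norm_inner` to be projected onto the
atomless subspace. -/
theorem unitaryAt_mem_atomlessSubspace (t : ℝ) {ψ : H} (hψ : ψ ∈ E.atomlessSubspace) :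
    E.unitaryAt t ψ ∈ E.atomlessSubspace :=
  E.mem_atomlessSubspace.2 fun x => E.proj_integral_eq_zero (measurable_exp_neg_I_mul t)
    (fun y => (norm_exp_neg_I_mul t y).le) (measurableSet_singleton x)
    (E.mem_atomlessSubspace.1 hψ x)

/-- The numbers `⟨ψ, U_n ψ⟩` are the Fourier coefficients of the spectral measure of `ψ`, so
Wiener's lemma applies. -/
theorem tendsto_cesaro_norm_inner_self {ψ : H} (hψ : ψ ∈ E.atomlessSubspace) :
    Tendsto (fun N : ℕ => (N : ℝ)⁻¹ * ∑ n ∈ Finset.range N, ‖⟪ψ, E.unitaryAt n ψ⟫_ℂ‖)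
      atTop (𝓝 0) := by
  have := E.nullSingletonClass_measure hψ
  refine tendsto_cesaro_of_sq (fun _ => norm_nonneg _) ?_
  refine (tendsto_cesaro_norm_sq_fourier (E.measure ψ)).congr fun N => ?_
  congr 1
  refine Finset.sum_congr rfl fun n _ => ?_
  rw [unitaryAt, E.inner_integral (measurable_exp_neg_I_mul n)
    (fun y => (norm_exp_neg_I_mul n y).le)]

/-- A vector whose spectral measure has no atoms leaves every state in time mean. -/
theorem tendsto_cesaro_norm_inner (φ : H) {ψ : H} (hψ : ψ ∈ E.atomlessSubspace) :
    Tendsto (fun N : ℕ => (N : ℝ)⁻¹ * ∑ n ∈ Finset.range N, ‖⟪φ, E.unitaryAt n ψ⟫_ℂ‖)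
      atTop (𝓝 0) := by
  have : CompleteSpace E.atomlessSubspace := E.isClosed_atomlessSubspace.completeSpace_coe
  have hφ' : E.atomlessSubspace.starProjection φ ∈ E.atomlessSubspace :=
    Submodule.starProjection_apply_mem _ _
  -- The orbit of `ψ` stays atomless, so only this component of `φ` is seen. All vectors `ψ + c •
  -- φ'` are then atomless, and polarization reduces the claim to the diagonal case.
  set φ' : H := E.atomlessSubspace.starProjection φ
  have hinner : ∀ t : ℝ, ⟪φ, E.unitaryAt t ψ⟫_ℂ = ⟪φ', E.unitaryAt t ψ⟫_ℂ := by
    intro t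
    have h := E.atomlessSubspace.sub_starProjection_mem_orthogonal φ
    have h1 := Submodule.inner_left_of_mem_orthogonal (E.unitaryAt_mem_atomlessSubspace t hψ) h
    rwa [inner_sub_left, sub_eq_zero] at h1
  have hmem : ∀ c : ℂ, ψ + c • φ' ∈ E.atomlessSubspace := fun c =>
    add_mem hψ (Submodule.smul_mem _ c hφ')
  have hsum := (((E.tendsto_cesaro_norm_inner_self (hmem 1)).add
    (E.tendsto_cesaro_norm_inner_self (hmem (-1)))).add
    (E.tendsto_cesaro_norm_inner_self (hmem Complex.I))).add
    (E.tendsto_cesaro_norm_inner_self (hmem (-Complex.I)))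
  simp only [add_zero] at hsum
  refine squeeze_zero (fun N => by positivity) (fun N => ?_) hsum
  rw [← mul_add, ← mul_add, ← mul_add, ← Finset.sum_add_distrib, ← Finset.sum_add_distrib,
    ← Finset.sum_add_distrib]
  gcongr with n _
  rw [hinner]
  set U := E.unitaryAt n
  have hpol : 4 * ⟪φ', U ψ⟫_ℂ = ⟪ψ + (1 : ℂ) • φ', U (ψ + (1 : ℂ) • φ')⟫_ℂ
      - ⟪ψ + (-1 : ℂ) • φ', U (ψ + (-1 : ℂ) • φ')⟫_ℂ
      + Complex.I * ⟪ψ + Complex.I • φ', U (ψ + Complex.I • φ')⟫_ℂ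
      - Complex.I * ⟪ψ + (-Complex.I) • φ', U (ψ + (-Complex.I) • φ')⟫_ℂ := by
    simp only [map_add, map_smul, inner_add_left, inner_add_right, inner_smul_left,
      inner_smul_right, Complex.conj_I, map_neg, map_one]
    linear_combination (2 * ⟪φ', U ψ⟫_ℂ - 2 * ⟪ψ, U φ'⟫_ℂ) * Complex.I_mul_I
  have h4 := congrArg norm hpol
  rw [norm_mul] at h4
  have h5 := norm_sub_le (⟪ψ + (1 : ℂ) • φ', U (ψ + (1 : ℂ) • φ')⟫_ℂ
      - ⟪ψ + (-1 : ℂ) • φ', U (ψ + (-1 : ℂ) • φ')⟫_ℂ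
      + Complex.I * ⟪ψ + Complex.I • φ', U (ψ + Complex.I • φ')⟫_ℂ)
      (Complex.I * ⟪ψ + (-Complex.I) • φ', U (ψ + (-Complex.I) • φ')⟫_ℂ)
  have h6 := norm_add_le (⟪ψ + (1 : ℂ) • φ', U (ψ + (1 : ℂ) • φ')⟫_ℂ
      - ⟪ψ + (-1 : ℂ) • φ', U (ψ + (-1 : ℂ) • φ')⟫_ℂ)
      (Complex.I * ⟪ψ + Complex.I • φ', U (ψ + Complex.I • φ')⟫_ℂ)
  have h7 := norm_sub_le ⟪ψ + (1 : ℂ) • φ', U (ψ + (1 : ℂ) • φ')⟫_ℂ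
      ⟪ψ + (-1 : ℂ) • φ', U (ψ + (-1 : ℂ) • φ')⟫_ℂ
  rw [norm_mul, Complex.norm_I, one_mul] at h5 h6
  have h8 : ‖(4 : ℂ)‖ = 4 := by norm_num
  rw [h8] at h4
  linarith [norm_nonneg ⟪φ', U ψ⟫_ℂ]

/-- A vector whose orbit has uniformly summable coefficients in some Hilbert basis is orthogonal to
the vectors without atoms. -/
theorem mem_orthogonal_atomlessSubspace {ι : Type*} (b : HilbertBasis ι ℂ H) {ψ : H} {a : ι → ℝ}
    (ha : Summable a) (hψ : ∀ (t : ℝ) (i : ι), ‖⟪b i, E.unitaryAt t ψ⟫_ℂ‖ ≤ a i) :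
    ψ ∈ E.atomlessSubspaceᗮ := by
  intro χ hχ
  have ha0 : ∀ i, 0 ≤ a i := fun i => (norm_nonneg _).trans (hψ 0 i)
  have hbound : ∀ (t : ℝ) (i : ι), ‖⟪b i, E.unitaryAt t χ⟫_ℂ‖ ≤ ‖χ‖ := fun t i => by
    simpa [b.orthonormal.1 i, E.norm_unitaryAt] using norm_inner_le_norm (b i) (E.unitaryAt t χ)
  have hsum : ∀ t : ℝ, Summable fun i => a i * ‖⟪b i, E.unitaryAt t χ⟫_ℂ‖ := fun t =>
    Summable.of_nonneg_of_le (fun i => mul_nonneg (ha0 i) (norm_nonneg _))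
      (fun i => mul_le_mul_of_nonneg_left (hbound t i) (ha0 i)) (ha.mul_right _)
  have hle : ∀ t : ℝ, ‖⟪χ, ψ⟫_ℂ‖ ≤ ∑' i, a i * ‖⟪b i, E.unitaryAt t χ⟫_ℂ‖ := by
    intro t
    -- Evolving both vectors to time `t` leaves the inner product unchanged; Parseval then expands
    -- it in the basis `b`.
    rw [← E.inner_unitaryAt_unitaryAt t, ← b.tsum_inner_mul_inner]
    refine tsum_of_norm_bounded (hsum t).hasSum fun i => ?_
    rw [norm_mul, norm_inner_symm, mul_comm]
    exact mul_le_mul_of_nonneg_right (hψ t i) (norm_nonneg _)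
  have hlim : Tendsto (fun N : ℕ => ∑' i, a i * ((N : ℝ)⁻¹ * ∑ n ∈ Finset.range N,
      ‖⟪b i, E.unitaryAt n χ⟫_ℂ‖)) atTop (𝓝 (∑' _ : ι, (0 : ℝ))) := by
    refine tendsto_tsum_of_dominated_convergence (ha.mul_right ‖χ‖) (fun i => ?_)
      (Eventually.of_forall fun N i => ?_)
    · simpa using (E.tendsto_cesaro_norm_inner (b i) hχ).const_mul (a i)
    · rw [Real.norm_of_nonneg (mul_nonneg (ha0 i) (by positivity))]
      refine mul_le_mul_of_nonneg_left ?_ (ha0 i)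
      calc (N : ℝ)⁻¹ * ∑ n ∈ Finset.range N, ‖⟪b i, E.unitaryAt n χ⟫_ℂ‖
          ≤ (N : ℝ)⁻¹ * ∑ n ∈ Finset.range N, ‖χ‖ := by
            gcongr with n _
            exact hbound n i
        _ = ((N : ℝ)⁻¹ * N) * ‖χ‖ := by simp [mul_assoc]
        _ ≤ 1 * ‖χ‖ := by gcongr; exact inv_mul_le_one
        _ = ‖χ‖ := one_mul _
  rw [tsum_zero] at hlim
  have hfin : ‖⟪χ, ψ⟫_ℂ‖ ≤ 0 := by
    -- Positive `N` is required: the empty average is `0`, not the constant `‖⟪χ, ψ⟫_ℂ‖`.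
    refine ge_of_tendsto hlim ((eventually_gt_atTop 0).mono fun N hN => ?_)
    have hN' : (0 : ℝ) < N := by exact_mod_cast hN
    calc ‖⟪χ, ψ⟫_ℂ‖ = (N : ℝ)⁻¹ * ∑ n ∈ Finset.range N, ‖⟪χ, ψ⟫_ℂ‖ := by
          simp [hN'.ne']
      _ ≤ (N : ℝ)⁻¹ * ∑ n ∈ Finset.range N, ∑' i, a i * ‖⟪b i, E.unitaryAt n χ⟫_ℂ‖ := by
          gcongr with n _
          exact hle n
      _ = ∑' i, a i * ((N : ℝ)⁻¹ * ∑ n ∈ Finset.range N, ‖⟪b i, E.unitaryAt n χ⟫_ℂ‖) := by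
          have hswap := Summable.tsum_finsetSum (s := Finset.range N)
            (f := fun (n : ℕ) i => a i * ‖⟪b i, E.unitaryAt n χ⟫_ℂ‖) fun n _ => hsum n
          rw [← hswap, ← tsum_mul_left]
          refine tsum_congr fun i => ?_
          rw [← Finset.mul_sum]
          ring
  exact norm_le_zero_iff.1 hfin

end ProjValuedMeasure

/-! ### Atoms of the spectral measure are eigenvalues -/

namespace IsSpectralMeasure

variable {E : ProjValuedMeasure H} {T : H →ₗ.[ℂ] H}

theorem measure_proj_singleton (E : ProjValuedMeasure H) (x : ℝ) (χ : H) :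
    E.measure (E.proj {x} χ) {x}ᶜ = 0 := by
  rw [E.measure_apply _ (measurableSet_singleton x).compl,
    E.proj_proj_apply (measurableSet_singleton x).compl (measurableSet_singleton x)]
  simp [E.proj_empty]

/-- `E B` annihilates the range of `E {x}` when `x ∉ B`, so the perturbation is invisible away from
`x`. -/
theorem measure_restrict_add_smul_proj_singleton (E : ProjValuedMeasure H) (x : ℝ) (ζ χ : H)
    (c : ℂ) : (E.measure (ζ + c • E.proj {x} χ)).restrict {x}ᶜ
      = (E.measure ζ).restrict {x}ᶜ := by
  ext B hB
  have hx := (measurableSet_singleton x).compl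
  rw [Measure.restrict_apply hB, Measure.restrict_apply hB, E.measure_apply _ (hB.inter hx),
    E.measure_apply _ (hB.inter hx), map_add, map_smul,
    E.proj_proj_apply (hB.inter hx) (measurableSet_singleton x)]
  simp [E.proj_empty]

theorem proj_singleton_mem_domain (hE : IsSpectralMeasure E T) (x : ℝ) (χ : H) :
    E.proj {x} χ ∈ T.domain := by
  rw [hE.mem_domain_iff]
  have h : (fun y : ℝ => y ^ 2) =ᵐ[E.measure (E.proj {x} χ)] fun _ => x ^ 2 := by
    refine measure_mono_null (fun y hy => ?_) (measure_proj_singleton E x χ)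
    intro h
    rw [Set.mem_singleton_iff] at h
    exact hy (by simp [h])
  exact (integrable_const _).congr h.symm

theorem integrable_id (hE : IsSpectralMeasure E T) (ζ : T.domain) :
    Integrable (fun y : ℝ => y) (E.measure (ζ : H)) := by
  have h := (hE.mem_domain_iff ζ).1 ζ.2
  refine (h.add (integrable_const (1 : ℝ))).mono' measurable_id.aestronglyMeasurable
    (Eventually.of_forall fun y => ?_)
  simp only [Pi.add_apply, Real.norm_eq_abs]
  nlinarith [sq_abs y, sq_nonneg (|y| - 1)]

/-- The integrand `y - x` vanishes at `x`, so the form of `T - x` ignores any mass there. -/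
theorem inner_apply_sub_smul (hE : IsSpectralMeasure E T) (x : ℝ) (ζ : T.domain) :
    ⟪(ζ : H), T ζ - (x : ℂ) • (ζ : H)⟫_ℂ
      = ((∫ y in ({x}ᶜ : Set ℝ), (y - x) ∂(E.measure (ζ : H)) : ℝ) : ℂ) := by
  have h1 : ∫ y in ({x}ᶜ : Set ℝ), (y - x) ∂(E.measure (ζ : H))
      = ∫ y, (y - x) ∂(E.measure (ζ : H)) := by
    refine setIntegral_eq_integral_of_forall_compl_eq_zero fun y hy => ?_
    simp only [Set.mem_compl_iff, Set.mem_singleton_iff, not_not] at hy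
    rw [hy, sub_self]
  rw [h1, integral_sub (hE.integrable_id ζ) (integrable_const _), inner_sub_right,
    hE.inner_apply, inner_smul_right, inner_self_eq_norm_sq_to_K, integral_const,
    E.measure_real_apply _ MeasurableSet.univ, E.proj_univ]
  simp [mul_comm]

/-- The range of `E {x}` consists of eigenvectors for `x`. -/
theorem apply_proj_singleton (hE : IsSpectralMeasure E T) (hT : Dense (T.domain : Set H)) (x : ℝ)
    (χ : H) : T ⟨E.proj {x} χ, hE.proj_singleton_mem_domain x χ⟩ = (x : ℂ) • E.proj {x} χ := by
  set η : T.domain := ⟨E.proj {x} χ, hE.proj_singleton_mem_domain x χ⟩ with hη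
  -- `IsSpectralMeasure` gives only the quadratic form of `T`. That of `T - x` takes the same value
  -- at `ζ + c • η` and at `ζ`, and vanishes at `η`; expanding leaves the cross terms.
  have key : ∀ (ζ : T.domain) (c : ℂ),
      c * ⟪(ζ : H), T η - (x : ℂ) • (η : H)⟫_ℂ
        + (starRingEnd ℂ) c * ⟪(η : H), T ζ - (x : ℂ) • (ζ : H)⟫_ℂ = 0 := by
    intro ζ c
    have h1 := hE.inner_apply_sub_smul x (ζ + c • η)
    have h2 := hE.inner_apply_sub_smul x ζ
    have h3 := hE.inner_apply_sub_smul x η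
    rw [Measure.restrict_eq_zero.2 (measure_proj_singleton E x χ)] at h3
    have h4 : (((ζ + c • η : T.domain)) : H) = ζ + c • E.proj {x} χ := rfl
    rw [h4, measure_restrict_add_smul_proj_singleton, ← h2, ← h4] at h1
    simp only [integral_zero_measure, Complex.ofReal_zero] at h3
    have h5 : T (ζ + c • η) - (x : ℂ) • ((ζ + c • η : T.domain) : H)
        = (T ζ - (x : ℂ) • (ζ : H)) + c • (T η - (x : ℂ) • (η : H)) := by
      rw [LinearPMap.map_add, LinearPMap.map_smul, Submodule.coe_add, Submodule.coe_smul]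
      module
    rw [h5, Submodule.coe_add, Submodule.coe_smul, inner_add_left, inner_add_right,
      inner_add_right, inner_smul_left, inner_smul_left, inner_smul_right, inner_smul_right,
      h3] at h1
    linear_combination h1
  -- Taking `c = 1` and `c = i` shows that the two cross terms have zero sum and zero difference.
  have hzero : ∀ ζ : T.domain, ⟪(ζ : H), T η - (x : ℂ) • (η : H)⟫_ℂ = 0 := by
    intro ζ
    have h1 := key ζ 1
    have h2 := key ζ Complex.I
    simp only [map_one, Complex.conj_I] at h1 h2
    have h3 : 2 * ⟪(ζ : H), T η - (x : ℂ) • (η : H)⟫_ℂ = 0 := by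
      linear_combination h1 - Complex.I * h2 + (⟪(ζ : H), T η - (x : ℂ) • (η : H)⟫_ℂ
        - ⟪(η : H), T ζ - (x : ℂ) • (ζ : H)⟫_ℂ) * Complex.I_mul_I
    simpa using h3
  have h := hT.eq_zero_of_inner_right (𝕜 := ℂ) (x := T η - (x : ℂ) • (η : H))
    (fun ζ hζ => hzero ⟨ζ, hζ⟩)
  exact sub_eq_zero.1 h

theorem proj_singleton_mem_pointSubspace (hE : IsSpectralMeasure E T)
    (hT : Dense (T.domain : Set H)) (x : ℝ) (χ : H) : E.proj {x} χ ∈ pointSubspace T :=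
  Submodule.le_topologicalClosure _
    (Submodule.subset_span ⟨_, x, hE.apply_proj_singleton hT x χ⟩)

/-- If `χ` is orthogonal to the eigenvector `E {x} χ`, then `‖E {x} χ‖² = ⟨E {x} χ, χ⟩ = 0`. -/
theorem orthogonal_pointSubspace_le (hE : IsSpectralMeasure E T)
    (hT : Dense (T.domain : Set H)) : (pointSubspace T)ᗮ ≤ E.atomlessSubspace := by
  intro χ hχ
  refine E.mem_atomlessSubspace.2 fun x => ?_
  have h := hχ _ (hE.proj_singleton_mem_pointSubspace hT x χ)
  rw [E.inner_proj_left (measurableSet_singleton x),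
    E.inner_proj_self (measurableSet_singleton x)] at h
  simpa using h

theorem contProj_eq_zero (hE : IsSpectralMeasure E T) (hT : Dense (T.domain : Set H)) {ψ : H}
    (hψ : ψ ∈ E.atomlessSubspaceᗮ) : contProj T ψ = 0 := by
  rw [contProj, Submodule.starProjection_apply_eq_zero_iff]
  exact Submodule.orthogonal_le (hE.orthogonal_pointSubspace_le hT) hψ

end IsSpectralMeasure

end Spectral

/-! ### The Anderson model -/

/-- The canonical orthonormal basis of `ℓ²(ℤ^d)`. -/
def standardBasis (d : ℕ) : HilbertBasis (Lattice d) ℂ (L2 d) :=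
  ⟨LinearIsometryEquiv.refl ℂ (L2 d)⟩

theorem standardBasis_apply {d : ℕ} (j : Lattice d) : standardBasis d j = basisVec j := by
  rw [← HilbertBasis.repr_symm_single]
  change (lp.single (E := fun _ : Lattice d => ℂ) 2 j 1 : L2 d) = lp.single 2 j 1
  congr

theorem basisVec_mem_domain {d : ℕ} (v : Lattice d → ℝ) (j : Lattice d) :
    basisVec j ∈ (hamiltonian v).domain := by
  change Memℓp (fun n => (v n : ℂ) * (basisVec j : L2 d) n) 2
  have h : (fun n => (v n : ℂ) * (basisVec j : L2 d) n)
      = ((v j : ℂ) • (basisVec j : L2 d) : L2 d) := by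
    ext n
    rw [lp.coeFn_smul, Pi.smul_apply, smul_eq_mul]
    by_cases hn : n = j
    · rw [hn]
    · simp [basisVec, lp.single_apply, Pi.single_eq_of_ne hn]
  rw [h]
  exact lp.memℓp _

theorem span_range_basisVec_topologicalClosure (d : ℕ) :
    (Submodule.span ℂ (Set.range (basisVec (d := d)))).topologicalClosure = ⊤ := by
  rw [← (standardBasis d).dense_span]
  congr
  ext1 j
  exact (standardBasis_apply j).symm

theorem dense_span_range_basisVec (d : ℕ) :
    Dense (Submodule.span ℂ (Set.range (basisVec (d := d))) : Set (L2 d)) := by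
  rw [Submodule.dense_iff_topologicalClosure_eq_top]
  exact span_range_basisVec_topologicalClosure d

theorem dense_domain_hamiltonian {d : ℕ} (v : Lattice d → ℝ) :
    Dense ((hamiltonian v).domain : Set (L2 d)) := by
  refine (dense_span_range_basisVec d).mono ?_
  have h : Submodule.span ℂ (Set.range (basisVec (d := d))) ≤ (hamiltonian v).domain := by
    rw [Submodule.span_le]
    rintro _ ⟨j, rfl⟩
    exact basisVec_mem_domain v j
  exact h

/-- A deterministic criterion: `h` has pure point spectrum in `I` as soon as the time suprema of the
matrix elements of `e^{-ith} χ_I(h)` are summable along columns. -/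
theorem hasPurePointSpectrumIn_of_summable {d : ℕ} (v : Lattice d → ℝ) {I : Set ℝ}
    (hI : MeasurableSet I)
    (h : ∀ k : Lattice d, Summable fun j : Lattice d => ⨆ t : ℝ,
      ‖⟪basisVec j, evolution (hamiltonian v) t (spectralProj (hamiltonian v) I (basisVec k))⟫_ℂ‖) :
    HasPurePointSpectrumIn (hamiltonian v) I := by
  -- Without a spectral measure `spectralProj` takes its default value `0` and the claim is trivial,
  -- so the spectral theorem is not invoked.
  by_cases hex : ∃ E : ProjValuedMeasure (L2 d), IsSpectralMeasure E (hamiltonian v)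
  · obtain ⟨E, hE, hcalc⟩ : ∃ E : ProjValuedMeasure (L2 d), IsSpectralMeasure E (hamiltonian v) ∧
        ∀ f : ℝ → ℂ, borelCalc (hamiltonian v) f = E.integral f :=
      ⟨hex.choose, hex.choose_spec, fun f => by rw [borelCalc, dif_pos hex]⟩
    have hproj : spectralProj (hamiltonian v) I = E.proj I := by
      rw [spectralProj, hcalc, E.integral_indicator_one hI]
    have hevol : ∀ t, evolution (hamiltonian v) t = E.unitaryAt t := fun t => hcalc _
    simp only [hproj, hevol] at h
    rw [HasPurePointSpectrumIn, hproj]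
    refine ContinuousLinearMap.ext_on (dense_span_range_basisVec d) ?_
    rintro _ ⟨k, rfl⟩
    rw [ContinuousLinearMap.comp_apply, zero_apply]
    refine hE.contProj_eq_zero (dense_domain_hamiltonian v) ?_
    refine E.mem_orthogonal_atomlessSubspace (standardBasis d) (h k) fun t j => ?_
    rw [standardBasis_apply]
    -- A real supremum bounds its terms only if the family is bounded above; Cauchy–Schwarz and
    -- unitarity supply the bound.
    refine le_ciSup (f := fun t : ℝ => ‖⟪basisVec j, E.unitaryAt t (E.proj I (basisVec k))⟫_ℂ‖)
      ⟨‖(basisVec j : L2 d)‖ * ‖E.proj I (basisVec k)‖, ?_⟩ t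
    rintro _ ⟨s, rfl⟩
    simpa [E.norm_unitaryAt] using
      norm_inner_le_norm (𝕜 := ℂ) (basisVec j) (E.unitaryAt s (E.proj I (basisVec k)))
  · rw [HasPurePointSpectrumIn, spectralProj, borelCalc, dif_neg hex, ContinuousLinearMap.comp_zero]

/-! ### Summability over the lattice and almost sure summability -/

theorem summable_exp_neg_mul_abs {m : ℝ} (hm : 0 < m) :
    Summable fun n : ℤ => Real.exp (-m * |(n : ℝ)|) := by
  have h : Summable fun n : ℕ => Real.exp (-m * n) := by
    simpa [mul_comm] using Real.summable_exp_nat_mul_iff.2 (neg_lt_zero.2 hm)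
  refine Summable.of_nat_of_neg ?_ ?_ <;> simpa using h

/-- The exponential of the `ℓ¹` norm factors over coordinates, so splitting one off gives a product
of summable families. -/
theorem summable_exp_neg_mul_graphNorm {m : ℝ} (hm : 0 < m) :
    ∀ d : ℕ, Summable fun n : Lattice d => Real.exp (-m * graphNorm n)
  | 0 => (hasSum_fintype _).summable
  | d + 1 => by
    rw [← (Fin.consEquiv fun _ : Fin (d + 1) => ℤ).summable_iff]
    refine ((summable_exp_neg_mul_abs hm).mul_of_nonneg (summable_exp_neg_mul_graphNorm hm d)
      (fun _ => (Real.exp_pos _).le) (fun _ => (Real.exp_pos _).le)).congr fun p => ?_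
    simp only [Function.comp_apply, Fin.consEquiv_apply, graphNorm, Fin.sum_univ_succ,
      Fin.cons_zero, Fin.cons_succ]
    rw [← Real.exp_add]
    push_cast
    ring_nf

/-- A countable family of nonnegative random variables with summable expectations is almost surely
summable. -/
theorem ae_summable_of_summable_integral {Ω ι : Type*} [MeasurableSpace Ω] [Countable ι]
    {P : Measure Ω} {X : ι → Ω → ℝ} (hX : ∀ i, Integrable (X i) P) (h0 : ∀ i ω, 0 ≤ X i ω)
    (hs : Summable fun i => ∫ ω, X i ω ∂P) : ∀ᵐ ω ∂P, Summable fun i => X i ω := by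
  have h1 : ∑' i, eLpNorm (X i) 1 P ≠ ⊤ := by
    have h2 : ∀ i, eLpNorm (X i) 1 P = ENNReal.ofReal (∫ ω, X i ω ∂P) := fun i => by
      rw [eLpNorm_one_eq_lintegral_enorm, ← ofReal_integral_norm_eq_lintegral_enorm (hX i)]
      simp [Real.norm_of_nonneg (h0 i _)]
    simp only [h2]
    exact hs.tsum_ofReal_ne_top
  filter_upwards [summable_norm_of_tsum_eLpNorm_ne_top le_rfl
    (fun i => (hX i).aestronglyMeasurable) h1] with ω hω
  exact hω.of_norm

theorem DynamicallyLocalized.ae_summable {Ω : Type*} [MeasurableSpace Ω] {d : ℕ} {P : Measure Ω}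
    {V : Lattice d → Ω → ℝ} {I : Set ℝ} (h : DynamicallyLocalized P V I) (k : Lattice d) :
    ∀ᵐ ω ∂P, Summable fun j : Lattice d => ⨆ t : ℝ,
      ‖⟪basisVec j, evolution (hamiltonian fun n => V n ω) t
        (spectralProj (hamiltonian fun n => V n ω) I (basisVec k))⟫_ℂ‖ := by
  obtain ⟨C, m, hm, hX⟩ := h
  have h0 : ∀ (j : Lattice d) (ω : Ω), 0 ≤ ⨆ t : ℝ,
      ‖⟪basisVec j, evolution (hamiltonian fun n => V n ω) t
        (spectralProj (hamiltonian fun n => V n ω) I (basisVec k))⟫_ℂ‖ := fun j ω =>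
    Real.iSup_nonneg fun t => norm_nonneg _
  refine ae_summable_of_summable_integral (fun j => (hX j k).1) h0 ?_
  refine Summable.of_nonneg_of_le (fun j => integral_nonneg (h0 j)) (fun j => (hX j k).2) ?_
  exact ((summable_exp_neg_mul_graphNorm hm d).comp_injective
    (sub_left_injective (b := k))).mul_left C

end Anderson

end

theorem proposition5p3 {Ω : Type*} [MeasurableSpace Ω] (P : MeasureTheory.Measure Ω)
    [MeasureTheory.IsProbabilityMeasure P] (d : ℕ) (hd : 1 ≤ d)
    (μ : MeasureTheory.Measure ℝ) (V : Anderson.Lattice d → Ω → ℝ)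
    (hV : Anderson.IsIIDPotential P μ V)
    (I : Set ℝ) (hI : IsOpen I) (hI' : I.OrdConnected)
    (hloc : Anderson.DynamicallyLocalized P V I) :
    ∀ᵐ ω ∂P, Anderson.HasPurePointSpectrumIn (Anderson.hamiltonian fun n => V n ω) I := by
  -- The lattice is countable, so a single event of full measure serves all columns `k`.
  filter_upwards [ae_all_iff.2 hloc.ae_summable] with ω hω
  exact Anderson.hasPurePointSpectrumIn_of_summable _ hI.measurableSet hω
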